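/- Let $G$ be a compact (Hausdorff, not necessarily abelian) group with normalized Haar measure $m_G$ on its Borel $\sigma$-algebra $\mathcal B(G)$, let $X$ be a complex Banach space with dual $X'$, and let $\nu:\mathcal B(G)\to X$ be a non-zero $\sigma$-additive vector measure. For $x'\in X'$ let $|\langle\nu,x'\rangle|$ be the total variation of the complex measure $A\mapsto\langle\nu(A),x'\rangle$, and put $\|\nu\|=\sup_{\|x'\|\le1}|\langle\nu,x'\rangle|(G)$. For a positive measure $\mu$, write $\nu\ll\mu$ if $\nu(A)\to0$ as $\mu(A)\to0$. A finite positive measure $\mu$ is a *Rybakov control measure* for $\nu$ if $\nu\ll\mu=|\langle\nu,x'\rangle|$ for some $x'\in X'$. A set $A\in\mathcal B(G)$ is *$\nu$-null* if $\nu(B)=0$ for all Borel $B\subset A$. For measurable $f:G\to\mathbb C$ put $\|f\|_\nu=\sup_{\|x'\|\le1}\int_G|f|\,d|\langle\nu,x'\rangle|$; $L^1_w(\nu)$ is the space of $f$ with $\|f\|_\nu<\infty$, and $L^1(\nu)$ is the closure of the simple functions in it. The *Köthe dual* $L^1(\nu)^*$ with respect to $\mu$ consists of the measurable $g:G\to\mathbb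 C$ with $fg\in L^1(\mu)$ for all $f\in L^1(\nu)$, with norm $\|g\|_{L^1(\nu)^*}=\sup\{\int_G|fg|\,d\mu: f\in L^1(\nu),\ \|f\|_\nu\le1\}$. Assume that $\nu\ll m_G$ and that $\nu$ is norm integral translation invariant: for every simple function $\phi=\sum_i\alpha_i\chi_{A_i}$ and every $s\in G$, $\|\int_G\tau_s\phi\,d\nu\|=\|\int_G\phi\,d\nu\|$, where $\tau_s\phi(t)=\phi(s^{-1}t)$ and $\int_G\phi\,d\nu=\sum_i\alpha_i\nu(A_i)$. Then: 1. $\nu$ has a Rybakov control measure, and for every Rybakov control measure $\mu$ of $\nu$ there is a function $h\in L^1(\nu)^*$ with $h>0$, $\|h\|_{L^1(\nu)^*}=\|\nu\|^{-1}$ and $$m_G(A)=\int_A h\,d\mu\qquad\text{for all }A\in\mathcal B(G).$$ 2. A set $A\in\mathcal B(G)$ is $\nu$-null if and only if $m_G(A)=0$. -/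

import Mathlib

open MeasureTheory
open scoped ENNReal

namespace VecMeas

/-- The scalar measure `⟨ν, x'⟩ : A ↦ x' (ν A)` for `x'` in the (complex) topological dual. -/
noncomputable def scalarMeasure {G X : Type*} [MeasurableSpace G]
    [NormedAddCommGroup X] [NormedSpace ℂ X]
    (ν : VectorMeasure G X) (x' : X →L[ℂ] ℂ) : ComplexMeasure G :=
  ν.mapRange x'.toLinearMap.toAddMonoidHom x'.continuous

/-- The total variation measure `|⟨ν, x'⟩|`. -/
noncomputable def absScalarMeasure {G X : Type*} [MeasurableSpace G]
    [NormedAddCommGroup X] [NormedSpace ℂ X]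
    (ν : VectorMeasure G X) (x' : X →L[ℂ] ℂ) : Measure G :=
  VectorMeasure.variation (scalarMeasure ν x')

/-- The semivariation `‖ν‖(A) = sup_{‖x'‖ ≤ 1} |⟨ν, x'⟩|(A)`, the supremum being over the unit ball
of the complex dual. -/
noncomputable def semivariation {G X : Type*} [MeasurableSpace G]
    [NormedAddCommGroup X] [NormedSpace ℂ X]
    (ν : VectorMeasure G X) (A : Set G) : ℝ≥0∞ :=
  ⨆ (x' : X →L[ℂ] ℂ) (_ : ‖x'‖ ≤ 1), absScalarMeasure ν x' A

/-- The total semivariation `‖ν‖ = ‖ν‖(G)`. -/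
noncomputable def totalSemivariation {G X : Type*} [MeasurableSpace G]
    [NormedAddCommGroup X] [NormedSpace ℂ X]
    (ν : VectorMeasure G X) : ℝ≥0∞ :=
  semivariation ν Set.univ

/-- `A` is `ν`-null: `ν B = 0` for every measurable `B ⊆ A`. -/
def IsNull {G X : Type*} [MeasurableSpace G] [NormedAddCommGroup X]
    (ν : VectorMeasure G X) (A : Set G) : Prop :=
  ∀ B : Set G, MeasurableSet B → B ⊆ A → ν B = 0

/-- `ν ≪ μ`: `ν A → 0` as `μ A → 0`, `A` measurable. -/
def AbsCont {G X : Type*} [MeasurableSpace G] [NormedAddCommGroup X]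
    (ν : VectorMeasure G X) (μ : Measure G) : Prop :=
  ∀ ε : ℝ, 0 < ε → ∃ δ : ℝ, 0 < δ ∧
    ∀ A : Set G, MeasurableSet A → μ A < ENNReal.ofReal δ → ‖ν A‖ < ε

/-- `μ` is a Rybakov control measure for `ν`: a finite positive measure such that
`ν ≪ μ = |⟨ν, x'⟩|` for some `x'` in the dual. -/
def IsRybakovControl {G X : Type*} [MeasurableSpace G]
    [NormedAddCommGroup X] [NormedSpace ℂ X]
    (ν : VectorMeasure G X) (μ : Measure G) : Prop :=
  IsFiniteMeasure μ ∧ AbsCont ν μ ∧ ∃ x' : X →L[ℂ] ℂ, μ = absScalarMeasure ν x'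

/-- The integral `I_ν(φ) = ∑ c, c • ν {φ = c}` of a complex simple function. -/
noncomputable def simpleIntegral {G X : Type*} [MeasurableSpace G]
    [NormedAddCommGroup X] [NormedSpace ℂ X]
    (ν : VectorMeasure G X) (φ : SimpleFunc G ℂ) : X :=
  ∑ c ∈ φ.range, c • ν (φ ⁻¹' {c})

/-- `ν` is norm integral `τ`-invariant for a homeomorphism `τ`: `‖I_ν(φ ∘ τ⁻¹)‖ = ‖I_ν(φ)‖` for
every simple function `φ`. -/
def IsNormIntegralInvariant {G X : Type*} [TopologicalSpace G] [MeasurableSpace G] [BorelSpace G]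
    [NormedAddCommGroup X] [NormedSpace ℂ X]
    (ν : VectorMeasure G X) (τ : G ≃ₜ G) : Prop :=
  ∀ φ : SimpleFunc G ℂ,
    ‖simpleIntegral ν (φ.comp τ.symm τ.symm.continuous.measurable)‖ = ‖simpleIntegral ν φ‖

/-- Norm integral translation invariance: invariance under each translation `t ↦ s * t`, so that
the transformed function is `τ_s φ (t) = φ (s⁻¹ * t)`. -/
def IsNormIntegralTranslationInvariant {G X : Type*} [TopologicalSpace G] [Group G]
    [IsTopologicalGroup G] [MeasurableSpace G] [BorelSpace G]
    [NormedAddCommGroup X] [NormedSpace ℂ X]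
    (ν : VectorMeasure G X) : Prop :=
  ∀ s : G, IsNormIntegralInvariant ν (Homeomorph.mulLeft s)

/-- The norm `‖f‖_ν = sup_{‖x'‖ ≤ 1} ∫ |f| d|⟨ν, x'⟩|`, with values in `[0, ∞]`. -/
noncomputable def l1Norm {G X : Type*} [MeasurableSpace G]
    [NormedAddCommGroup X] [NormedSpace ℂ X]
    (ν : VectorMeasure G X) (f : G → ℂ) : ℝ≥0∞ :=
  ⨆ (x' : X →L[ℂ] ℂ) (_ : ‖x'‖ ≤ 1), ∫⁻ t, ‖f t‖ₑ ∂(absScalarMeasure ν x')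

/-- `f ∈ L¹_w(ν)`: measurable with `‖f‖_ν < ∞`. -/
def MemL1Weak {G X : Type*} [MeasurableSpace G]
    [NormedAddCommGroup X] [NormedSpace ℂ X]
    (ν : VectorMeasure G X) (f : G → ℂ) : Prop :=
  Measurable f ∧ l1Norm ν f < ∞

/-- `f ∈ L¹(ν)`: the closure of the simple functions in `L¹_w(ν)`. -/
def MemL1 {G X : Type*} [MeasurableSpace G]
    [NormedAddCommGroup X] [NormedSpace ℂ X]
    (ν : VectorMeasure G X) (f : G → ℂ) : Prop :=
  MemL1Weak ν f ∧ ∀ ε : ℝ≥0∞, 0 < ε → ∃ φ : SimpleFunc G ℂ, l1Norm ν (fun t => f t - φ t) < ε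

/-- `g` belongs to the Köthe dual `L¹(ν)*`, taken with respect to `μ`: `g` is measurable and
`f g ∈ L¹(μ)` for every `f ∈ L¹(ν)`. -/
def MemKotheDual {G X : Type*} [MeasurableSpace G]
    [NormedAddCommGroup X] [NormedSpace ℂ X]
    (ν : VectorMeasure G X) (μ : Measure G) (g : G → ℂ) : Prop :=
  Measurable g ∧ ∀ f : G → ℂ, MemL1 ν f → Integrable (fun t => f t * g t) μ

/-- The Köthe dual norm `sup {∫ |f g| dμ : f ∈ L¹(ν), ‖f‖_ν ≤ 1}`. -/
noncomputable def kotheDualNorm {G X : Type*} [MeasurableSpace G]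
    [NormedAddCommGroup X] [NormedSpace ℂ X]
    (ν : VectorMeasure G X) (μ : Measure G) (g : G → ℂ) : ℝ≥0∞ :=
  ⨆ (f : G → ℂ) (_ : MemL1 ν f) (_ : l1Norm ν f ≤ 1), ∫⁻ t, ‖f t * g t‖ₑ ∂μ

end VecMeas

/-! Since `ν ≪ m`, every scalar measure `⟨ν, x'⟩` has a density `D x'` in `L¹(m)`, and `D` is a
bounded operator by the closed graph theorem. All norms in the statement become integrals against
`|D x'|`.

The core is the inequality `‖ν‖ ∫ |f| dm ≤ ‖f‖_ν`. For simple `φ` and `‖x'‖ ≤ 1`, the integral `∫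
|φ(st)| |D x'(t)| dm(t)` is a limit of values of `x'` at integrals of translates of simple functions
dominated by `|φ|`. Invariance removes the translation, so `‖φ‖_ν` bounds it for every `s`.
Averaging over `s` decouples the two factors into `∫ |φ| dm · |⟨ν, x'⟩|(G)`; then take the supremum
over `x'`. Applied to indicators, the inequality shows that `ν`-null sets are `m`-null.

For a Rybakov control measure, a Baire category argument finds `x'` whose density has, up to null
sets, the largest support. Its zero set is `ν`-null, hence `m`-null, so `m ≪ |⟨ν, x'⟩|`. For any
control measure `|⟨ν, x'⟩|`, the density `D x'` is likewise nonzero almost everywhere, and `h = |D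
x'|⁻¹`. The inequality bounds the Köthe dual norm of `h`, and constants attain the bound. -/

namespace VecMeas

open Filter Topology

/-! ### Radon–Nikodym densities of the scalar measures -/

section Density

variable {α : Type*} [MeasurableSpace α] {m : Measure α}

lemma exists_setIntegral_eq_of_complexMeasure [IsFiniteMeasure m] (c : ComplexMeasure α)
    (hc : ∀ A, MeasurableSet A → m A = 0 → c A = 0) :
    ∃ f : Lp ℂ 1 m, ∀ A, MeasurableSet A → ∫ t in A, f t ∂m = c A := by
  have hre : c.re ≪ᵥ m.toENNRealVectorMeasure := by
    refine VectorMeasure.AbsolutelyContinuous.mk fun A hA h0 => ?_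
    rw [Measure.toENNRealVectorMeasure_apply_measurable hA] at h0
    change (c A).re = 0
    simp [hc A hA h0]
  have him : c.im ≪ᵥ m.toENNRealVectorMeasure := by
    refine VectorMeasure.AbsolutelyContinuous.mk fun A hA h0 => ?_
    rw [Measure.toENNRealVectorMeasure_apply_measurable hA] at h0
    change (c A).im = 0
    simp [hc A hA h0]
  have hint := c.integrable_rnDeriv m
  refine ⟨hint.toL1 _, fun A hA => ?_⟩
  rw [setIntegral_congr_ae hA ((hint.coeFn_toL1).mono fun t ht _ => ht)]
  apply Complex.ext
  · rw [← RCLike.re_eq_complex_re, ← integral_re hint.integrableOn]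
    have := congrArg (fun v => v A) (SignedMeasure.withDensityᵥ_rnDeriv_eq _ m hre)
    simp only [withDensityᵥ_apply (SignedMeasure.integrable_rnDeriv _ _) hA] at this
    exact this
  · rw [← RCLike.im_eq_complex_im, ← integral_im hint.integrableOn]
    have := congrArg (fun v => v A) (SignedMeasure.withDensityᵥ_rnDeriv_eq _ m him)
    simp only [withDensityᵥ_apply (SignedMeasure.integrable_rnDeriv _ _) hA] at this
    exact this

lemma Lp_ext_of_setIntegral_eq {f g : Lp ℂ 1 m}
    (h : ∀ A, MeasurableSet A → ∫ t in A, f t ∂m = ∫ t in A, g t ∂m) : f = g :=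
  Lp.ext ((L1.integrable_coeFn f).ae_eq_of_forall_setIntegral_eq _ _ (L1.integrable_coeFn g)
    fun A hA _ => h A hA)

lemma AbsCont.apply_eq_zero {X : Type*} [NormedAddCommGroup X] {ν : VectorMeasure α X}
    {μ : Measure α} (h : AbsCont ν μ) {A : Set α} (hA : MeasurableSet A) (h0 : μ A = 0) :
    ν A = 0 := by
  rw [← norm_eq_zero]
  refine le_antisymm (le_of_forall_pos_lt_add fun ε hε => ?_) (norm_nonneg _)
  obtain ⟨δ, hδ, H⟩ := h ε hε
  simpa using H A hA (by simpa [h0] using hδ)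

variable {X : Type*} [NormedAddCommGroup X] [NormedSpace ℂ X]

/-- The Radon-Nikodym densities `d⟨ν, x'⟩ / dm` depend linearly and continuously on `x'`. -/
lemma AbsCont.exists_density [IsFiniteMeasure m] {ν : VectorMeasure α X} (h : AbsCont ν m) :
    ∃ D : (X →L[ℂ] ℂ) →L[ℂ] Lp ℂ 1 m,
      ∀ x' A, MeasurableSet A → ∫ t in A, D x' t ∂m = x' (ν A) := by
  have key : ∀ x' : X →L[ℂ] ℂ, ∃ f : Lp ℂ 1 m,
      ∀ A, MeasurableSet A → ∫ t in A, f t ∂m = x' (ν A) := fun x' =>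
    exists_setIntegral_eq_of_complexMeasure (scalarMeasure ν x') fun A hA h0 => by
      change x' (ν A) = 0
      rw [h.apply_eq_zero hA h0, map_zero]
  choose D hD using key
  have hint (f : Lp ℂ 1 m) (A : Set α) : Integrable f (m.restrict A) :=
    (L1.integrable_coeFn f).integrableOn
  let L : (X →L[ℂ] ℂ) →ₗ[ℂ] Lp ℂ 1 m :=
    { toFun := D
      map_add' := fun x y => Lp_ext_of_setIntegral_eq fun A hA => by
        rw [hD _ A hA, setIntegral_congr_ae hA ((Lp.coeFn_add (D x) (D y)).mono fun t ht _ => ht)]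
        simp only [Pi.add_apply]
        rw [integral_add (hint _ A) (hint _ A), hD _ A hA, hD _ A hA]
        rfl
      map_smul' := fun a x => Lp_ext_of_setIntegral_eq fun A hA => by
        rw [RingHom.id_apply, hD _ A hA,
          setIntegral_congr_ae hA ((Lp.coeFn_smul a (D x)).mono fun t ht _ => ht)]
        simp only [Pi.smul_apply]
        rw [integral_smul, hD _ A hA]
        rfl }
  -- Closed graph: an `L¹` limit is determined by its integrals over sets, and these equal `x' (ν
  -- A)`, which is continuous in `x'`.
  have hL : Continuous L := by
    refine L.continuous_of_seq_closed_graph fun u x y hu hy => ?_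
    refine Lp_ext_of_setIntegral_eq fun A hA => ?_
    have h1 : Tendsto (fun n => ∫ t in A, L (u n) t ∂m) atTop (𝓝 (∫ t in A, y t ∂m)) :=
      ((continuous_setIntegral A).tendsto y).comp hy
    have h2 : Tendsto (fun n => u n (ν A)) atTop (𝓝 (x (ν A))) :=
      ((ContinuousLinearMap.apply ℂ ℂ (ν A)).continuous.tendsto x).comp hu
    have h3 : (fun n => ∫ t in A, L (u n) t ∂m) = fun n => u n (ν A) :=
      funext fun n => hD (u n) A hA
    rw [h3] at h1
    rw [tendsto_nhds_unique h1 h2]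
    exact (hD x A hA).symm
  exact ⟨⟨L, hL⟩, hD⟩

lemma absScalarMeasure_eq_withDensity {ν : VectorMeasure α X} {x' : X →L[ℂ] ℂ} {f : α → ℂ}
    (hf : Integrable f m) (h : ∀ A, MeasurableSet A → ∫ t in A, f t ∂m = x' (ν A)) :
    absScalarMeasure ν x' = m.withDensity fun t => ‖f t‖ₑ := by
  have : scalarMeasure ν x' = m.withDensityᵥ f := by
    ext A hA
    rw [withDensityᵥ_apply hf hA, h A hA]
    rfl
  rw [absScalarMeasure, this, Measure.variation_withDensityᵥ hf]

lemma apply_simpleIntegral {ν : VectorMeasure α X} {x' : X →L[ℂ] ℂ} {f : α → ℂ}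
    (hf : Integrable f m) (h : ∀ A, MeasurableSet A → ∫ t in A, f t ∂m = x' (ν A))
    (φ : SimpleFunc α ℂ) : x' (simpleIntegral ν φ) = ∫ t, φ t * f t ∂m := by
  have h1 : ∀ t, φ t * f t = ∑ c ∈ φ.range, (φ ⁻¹' {c} : Set α).indicator (fun t => c * f t) t := by
    intro t
    rw [Finset.sum_eq_single (φ t)]
    · simp
    · intro c _ hc
      exact Set.indicator_of_notMem (s := (φ ⁻¹' {c} : Set α)) (f := fun t => c * f t)
        fun ht => hc (Set.mem_singleton_iff.1 ht).symm
    · simp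
  simp_rw [h1]
  rw [integral_finsetSum _ fun c _ => (hf.const_mul c).indicator (φ.measurableSet_fiber c)]
  simp_rw [integral_indicator (φ.measurableSet_fiber _), integral_const_mul,
    h _ (φ.measurableSet_fiber _)]
  simp [simpleIntegral]

end Density

/-! ### A density of maximal support, by Baire category -/

section Support

variable {α : Type*} [MeasurableSpace α] {m : Measure α}

/-- For all but countably many `z`, the zeros of `f + z g` are common zeros of `f` and `g`. -/
lemma exists_countable_forall_notMem_ae_add_mul_eq_zero [IsFiniteMeasure m] {f g : α → ℂ} (hf : Measurable f)
    (hg : Measurable g) :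
    ∃ T : Set ℂ, T.Countable ∧ ∀ z ∉ T, ∀ᵐ t ∂m, f t + z * g t = 0 → f t = 0 ∧ g t = 0 := by
  let S : ℂ → Set α := fun z => {t | f t + z * g t = 0 ∧ g t ≠ 0}
  have hS (z : ℂ) : MeasurableSet (S z) :=
    ((hf.add (hg.const_mul z)) (measurableSet_singleton 0)).inter
      (hg (measurableSet_singleton 0)).compl
  -- On `S z` one has `z = -f/g`, so these sets are disjoint and only countably many carry positive
  -- mass.
  refine ⟨{z | 0 < m (S z)},
    Measure.countable_meas_pos_of_disjoint_iUnion hS fun z w hzw => ?_, fun z hz => ?_⟩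
  · refine Set.disjoint_left.2 fun t ht hw => hzw ?_
    exact mul_right_cancel₀ ht.2 (add_left_cancel (ht.1.trans hw.1.symm))
  · have h0 : m (S z) = 0 := by simpa using hz
    filter_upwards [measure_eq_zero_iff_ae_notMem.1 h0] with t ht h1
    have hgt : g t = 0 := by
      by_contra hgt
      exact ht ⟨h1, hgt⟩
    exact ⟨by simpa [hgt] using h1, hgt⟩

/-- These truncations, each `K`-Lipschitz on `L¹`, increase to the measure of the support of `f` as
`K → ∞`. -/
lemma continuous_integral_min_one_mul_norm [IsFiniteMeasure m] (K : ℕ) :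
    Continuous fun f : Lp ℂ 1 m => ∫ t, min 1 (K * ‖f t‖) ∂m := by
  have hint (f : Lp ℂ 1 m) : Integrable (fun t => min 1 (K * ‖f t‖)) m :=
    (integrable_const 1).inf ((L1.integrable_coeFn f).norm.const_mul _)
  refine (LipschitzWith.of_dist_le_mul (K := (K : NNReal)) fun f g => ?_).continuous
  rw [Real.dist_eq, ← integral_sub (hint f) (hint g), dist_eq_norm, L1.norm_eq_integral_norm,
    ← integral_const_mul]
  refine (norm_integral_le_integral_norm _).trans
    (integral_mono_ae ((hint f).sub (hint g)).norm ((L1.integrable_coeFn _).norm.const_mul _) ?_)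
  filter_upwards [Lp.coeFn_sub f g] with t ht
  simp only [Real.norm_eq_abs, ht, Pi.sub_apply, NNReal.coe_natCast]
  refine (abs_min_sub_min_le_max _ _ _ _).trans ?_
  rw [sub_self, abs_zero, max_eq_right (abs_nonneg _), ← mul_sub, abs_mul, Nat.abs_cast]
  exact mul_le_mul_of_nonneg_left (abs_norm_sub_norm_le _ _) (Nat.cast_nonneg _)

lemma measurableSet_Lp_ne_zero (f : Lp ℂ 1 m) : MeasurableSet {t | f t ≠ 0} :=
  ((Lp.stronglyMeasurable f).measurable (measurableSet_singleton 0)).compl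

lemma tendsto_integral_min_one_mul_norm [IsFiniteMeasure m] (f : Lp ℂ 1 m) :
    Tendsto (fun K : ℕ => ∫ t, min 1 (K * ‖f t‖) ∂m) atTop (𝓝 (m.real {t | f t ≠ 0})) := by
  rw [← integral_indicator_one (measurableSet_Lp_ne_zero f)]
  refine tendsto_integral_of_dominated_convergence (fun _ => 1) (fun K => ?_)
    (integrable_const 1) (fun K => .of_forall fun t => ?_) (.of_forall fun t => ?_)
  · exact ((integrable_const (1 : ℝ)).inf
      ((L1.integrable_coeFn f).norm.const_mul _)).aestronglyMeasurable
  · rw [Real.norm_of_nonneg (by positivity)]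
    exact min_le_left _ _
  · by_cases h : f t = 0
    · simp [h]
    · rw [Set.indicator_of_mem (by exact h)]
      have h1 : Tendsto (fun K : ℕ => (K : ℝ) * ‖f t‖) atTop atTop :=
        tendsto_natCast_atTop_atTop.atTop_mul_const (norm_pos_iff.2 h)
      refine tendsto_const_nhds.congr' ?_
      filter_upwards [h1.eventually_ge_atTop 1] with K hK
      simp [hK]

lemma integral_min_one_mul_norm_le [IsFiniteMeasure m] (f : Lp ℂ 1 m) (K : ℕ) :
    ∫ t, min 1 (K * ‖f t‖) ∂m ≤ m.real {t | f t ≠ 0} := by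
  rw [← integral_indicator_one (measurableSet_Lp_ne_zero f)]
  refine integral_mono ((integrable_const (1 : ℝ)).inf
      ((L1.integrable_coeFn f).norm.const_mul _))
      ((integrable_const 1).indicator (measurableSet_Lp_ne_zero f)) fun t => ?_
  by_cases h : f t = 0
  · simp [h]
  · rw [Set.indicator_of_mem (by exact h)]
    exact min_le_left _ _

/-- The measure of the support is lower semicontinuous on `L¹`, being a supremum of continuous
functions. This supplies the open sets for Baire's theorem. -/
lemma isOpen_setOf_lt_measureReal_ne_zero [IsFiniteMeasure m] (r : ℝ) :
    IsOpen {f : Lp ℂ 1 m | r < m.real {t | f t ≠ 0}} := by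
  have : {f : Lp ℂ 1 m | r < m.real {t | f t ≠ 0}} =
      ⋃ K : ℕ, {f : Lp ℂ 1 m | r < ∫ t, min 1 (K * ‖f t‖) ∂m} := by
    ext f
    simp only [Set.mem_ofPred_eq, Set.mem_iUnion]
    refine ⟨fun h => ?_, fun ⟨K, hK⟩ => hK.trans_le (integral_min_one_mul_norm_le f K)⟩
    exact ((tendsto_integral_min_one_mul_norm f).eventually (lt_mem_nhds h)).exists
  rw [this]
  exact isOpen_iUnion fun K =>
    isOpen_lt continuous_const (continuous_integral_min_one_mul_norm K)

variable {E : Type*} [NormedAddCommGroup E] [NormedSpace ℂ E]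

lemma ae_map_add_smul (D : E →L[ℂ] Lp ℂ 1 m) (x y : E) (z : ℂ) :
    ∀ᵐ t ∂m, D (x + z • y) t = D x t + z * D y t := by
  rw [map_add, map_smul]
  filter_upwards [Lp.coeFn_add (D x) (z • D y), Lp.coeFn_smul z (D y)] with t h1 h2
  rw [h1, Pi.add_apply, h2, Pi.smul_apply, smul_eq_mul]

/-- A bounded operator into `L¹` has a value whose support contains the supports of all others. -/
theorem exists_forall_ae_eq_zero_imp [IsFiniteMeasure m] [CompleteSpace E] (D : E →L[ℂ] Lp ℂ 1 m) :
    ∃ x, ∀ y, ∀ᵐ t ∂m, D x t = 0 → D y t = 0 := by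
  let V : E → ℝ := fun x => m.real {t | D x t ≠ 0}
  have hbdd : BddAbove (Set.range V) :=
    ⟨m.real Set.univ, by rintro _ ⟨x, rfl⟩; exact measureReal_mono (Set.subset_univ _)⟩
  have hgen (x y : E) : ∃ T : Set ℂ, T.Countable ∧ ∀ z ∉ T,
      m.real ({t | D x t ≠ 0} ∪ {t | D y t ≠ 0}) ≤ V (x + z • y) := by
    obtain ⟨T, hT, h⟩ := exists_countable_forall_notMem_ae_add_mul_eq_zero (m := m)
      (Lp.stronglyMeasurable (D x)).measurable (Lp.stronglyMeasurable (D y)).measurable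
    refine ⟨T, hT, fun z hz => ?_⟩
    refine ENNReal.toReal_mono (measure_ne_top _ _) (measure_mono_ae ?_)
    filter_upwards [h z hz, ae_map_add_smul D x y z] with t h1 h2 h3 h4
    rw [h2] at h4
    have := h1 h4
    rcases h3 with h3 | h3
    · exact h3 this.1
    · exact h3 this.2
  -- Points whose support is within `1 / (n + 1)` of the largest possible measure; a point in all
  -- the `U n` attains the supremum.
  let U : ℕ → Set E := fun n => {x | (⨆ x, V x) - 1 / ((n : ℝ) + 1) < V x}
  have hUo (n : ℕ) : IsOpen (U n) := (isOpen_setOf_lt_measureReal_ne_zero _).preimage D.continuous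
  have hUd (n : ℕ) : Dense (U n) := by
    intro x
    obtain ⟨y, hy⟩ := exists_lt_of_lt_ciSup
      (show (⨆ x, V x) - 1 / ((n : ℝ) + 1) < ⨆ x, V x from sub_lt_self _ (by positivity))
    obtain ⟨T, hT, h⟩ := hgen x y
    have hcont : Continuous fun z : ℂ => x + z • y := by fun_prop
    -- Generic `z` arbitrarily close to `0` put `x + z • y` near `x`, with support at least as large
    -- as that of `D y`.
    have h0 : (0 : ℂ) ∈ closure Tᶜ := (hT.dense_compl ℂ) 0
    have := map_mem_closure hcont h0 (t := U n) fun z hz =>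
      (hy.trans_le ((measureReal_mono Set.subset_union_right).trans (h z hz)) :)
    simpa using this
  obtain ⟨x, hx⟩ := (dense_iInter_of_isOpen hUo hUd).nonempty
  have hxmax : (⨆ x, V x) ≤ V x := by
    refine le_of_forall_pos_lt_add fun ε hε => ?_
    obtain ⟨n, hn⟩ := exists_nat_one_div_lt hε
    have : (⨆ x, V x) - 1 / ((n : ℝ) + 1) < V x := Set.mem_iInter.1 hx n
    linarith
  refine ⟨x, fun y => ?_⟩
  obtain ⟨T, hT, h⟩ := hgen x y
  obtain ⟨z, hz⟩ := (hT.dense_compl ℂ).nonempty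
  -- If the support of `D y` left that of `D x` on a set of positive measure, a generic `x + z • y`
  -- would exceed the maximum.
  have hle : m.real ({t | D x t ≠ 0} ∪ {t | D y t ≠ 0}) ≤ m.real {t | D x t ≠ 0} :=
    ((h z hz).trans (le_ciSup hbdd _)).trans hxmax
  have hdiff : m ({t | D y t ≠ 0} \ {t | D x t ≠ 0}) = 0 := by
    rw [← measureReal_eq_zero_iff]
    have := measureReal_union (μ := m) (s₁ := {t | D x t ≠ 0})
      (s₂ := {t | D y t ≠ 0} \ {t | D x t ≠ 0}) Set.disjoint_sdiff_right
      ((measurableSet_Lp_ne_zero _).diff (measurableSet_Lp_ne_zero _))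
    rw [Set.union_sdiff_self] at this
    linarith [measureReal_nonneg (μ := m) (s := {t | D y t ≠ 0} \ {t | D x t ≠ 0})]
  filter_upwards [measure_eq_zero_iff_ae_notMem.1 hdiff] with t ht h0
  by_contra h1
  exact ht ⟨h1, fun h2 => h2 h0⟩

end Support

/-! ### Averaging over translations -/

section Average

variable {G : Type*} [Group G] [TopologicalSpace G] [IsTopologicalGroup G] [CompactSpace G]
  [MeasurableSpace G] [BorelSpace G] (m : Measure G) [m.IsHaarMeasure]
  [IsProbabilityMeasure m]

lemma isMulRightInvariant_of_compactSpace : m.IsMulRightInvariant := by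
  refine ⟨fun g => ?_⟩
  have : IsProbabilityMeasure (m.map (· * g)) :=
    Measure.isProbabilityMeasure_map (measurable_mul_const g).aemeasurable
  exact Measure.isHaarMeasure_eq_of_isProbabilityMeasure _ _

variable {m}

/-- Integrating in `s` first, right invariance removes `t`. Continuity is what permits the exchange:
without second countability, `u (s * t)` for Borel `u` need not be measurable for the product
σ-algebra. -/
lemma integral_integral_mul_left_comp {u v : G → ℝ} (hu : Continuous u) (hv : Continuous v) :
    ∫ s, ∫ t, u (s * t) * v t ∂m ∂m = (∫ t, u t ∂m) * ∫ t, v t ∂m := by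
  have := isMulRightInvariant_of_compactSpace m
  rw [integral_integral_swap_of_hasCompactSupport (by fun_prop) (.of_compactSpace _)]
  simp_rw [integral_mul_const, integral_mul_right_eq_self u]
  rw [integral_const_mul]

/-- If all the integrals `∫ u(st) v(t) dm(t)` are at most `C`, so is their average `∫ u * ∫ v`. -/
lemma integral_mul_integral_le_of_forall {u v : G → ℝ} {B C : ℝ}
    (hu : Integrable u m) (hB : ∀ t, |u t| ≤ B) (hv : Integrable v m)
    (h : ∀ s, ∫ t, u (s * t) * v t ∂m ≤ C) : (∫ t, u t ∂m) * ∫ t, v t ∂m ≤ C := by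
  have hB0 : 0 ≤ B := (abs_nonneg _).trans (hB 1)
  suffices H : ∀ ε : ℝ, 0 < ε → (∫ t, u t ∂m) * ∫ t, v t ∂m ≤ C + (2 * B + 2) * ε by
    refine le_of_forall_pos_le_add fun ε hε => ?_
    -- The error is `(B + 1) ε` from `hbound`, `B ε` from `h5` and `ε` from `h6`.
    have := H (ε / (2 * B + 2)) (by positivity)
    rwa [mul_div_cancel₀ _ (by positivity)] at this
  intro ε hε
  obtain ⟨g, -, hgε, hg, hgi⟩ := hv.exists_hasCompactSupport_integral_sub_le hε
  obtain ⟨M, hM⟩ : ∃ M : ℝ, 0 < M ∧ ∀ t, |g t| ≤ M := by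
    obtain ⟨M, hM⟩ := (isCompact_range hg.norm).bddAbove
    exact ⟨max M 1, by positivity, fun t => (hM ⟨t, rfl⟩).trans (le_max_left _ _)⟩
  obtain ⟨hM0, hM⟩ := hM
  -- The error in `u` gets multiplied by `g`, so `g` and its bound `M` must be fixed before `w` is
  -- chosen within `ε / M`.
  obtain ⟨w, -, hwε, hw, hwi⟩ := hu.exists_hasCompactSupport_integral_sub_le (div_pos hε hM0)
  have hus (s : G) : Integrable (fun t => u (s * t)) m := hu.comp_mul_left s
  have hws (s : G) : Integrable (fun t => w (s * t)) m := hwi.comp_mul_left s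
  have hvg : Integrable (fun t => v t - g t) m := hv.sub hgi
  have hbound (s : G) : ∫ t, w (s * t) * g t ∂m ≤ C + (B + 1) * ε := by
    have i1 : Integrable (fun t => u (s * t) * v t) m :=
      hv.bdd_mul (hus s).aestronglyMeasurable (.of_forall fun t => hB _)
    have i2 : Integrable (fun t => B * ‖v t - g t‖) m := hvg.norm.const_mul B
    have i3 : Integrable (fun t => M * ‖u (s * t) - w (s * t)‖) m :=
      ((hus s).sub (hws s)).norm.const_mul M
    have i4 : Integrable (fun t => w (s * t) * g t) m :=
      (hws s).mul_bdd hg.aestronglyMeasurable (.of_forall fun t => hM _)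
    calc ∫ t, w (s * t) * g t ∂m
        ≤ ∫ t, (u (s * t) * v t + B * ‖v t - g t‖ + M * ‖u (s * t) - w (s * t)‖) ∂m := by
          refine integral_mono i4 ((i1.add i2).add i3) fun t => ?_
          have h1 : -(u (s * t) * (v t - g t)) ≤ B * ‖v t - g t‖ := by
            refine (neg_le_abs _).trans ?_
            rw [abs_mul]
            exact mul_le_mul_of_nonneg_right (hB _) (abs_nonneg _)
          have h2 : -((u (s * t) - w (s * t)) * g t) ≤ M * ‖u (s * t) - w (s * t)‖ := by
            refine (neg_le_abs _).trans ?_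
            rw [abs_mul, mul_comm]
            exact mul_le_mul_of_nonneg_right (hM _) (abs_nonneg _)
          simp only
          linarith
      _ = ∫ t, u (s * t) * v t ∂m + B * ∫ t, ‖v t - g t‖ ∂m
            + M * ∫ t, ‖u t - w t‖ ∂m := by
          rw [integral_add (by exact i1.add i2) i3, integral_add i1 i2, integral_const_mul,
            integral_const_mul, integral_mul_left_eq_self (fun t => ‖u t - w t‖)]
      _ ≤ C + B * ε + M * (ε / M) := by
          gcongr
          exact h s
      _ = C + (B + 1) * ε := by
          rw [mul_div_cancel₀ _ hM0.ne']
          ring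
  have havg : (∫ t, w t ∂m) * ∫ t, g t ∂m ≤ C + (B + 1) * ε := by
    rw [← integral_integral_mul_left_comp hw hg]
    have hcont : Continuous fun s => ∫ t, w (s * t) * g t ∂m := by
      rw [← continuousOn_univ]
      refine continuousOn_integral_of_compact_support (k := Set.univ) isCompact_univ
        (Continuous.continuousOn ?_) (by simp)
      simp only [Function.uncurry_def]
      fun_prop
    refine (integral_mono (hcont.integrable_of_hasCompactSupport (.of_compactSpace _))
      (integrable_const _) hbound).trans_eq (by simp)
  have h1 : |(∫ t, v t ∂m) - ∫ t, g t ∂m| ≤ ε := by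
    rw [← integral_sub hv hgi]
    exact (norm_integral_le_integral_norm _).trans hgε
  have h2 : |(∫ t, u t ∂m) - ∫ t, w t ∂m| ≤ ε / M := by
    rw [← integral_sub hu hwi]
    exact (norm_integral_le_integral_norm _).trans hwε
  have h3 : |∫ t, u t ∂m| ≤ B := by
    simpa using norm_integral_le_of_norm_le_const (μ := m) (f := u) (.of_forall hB)
  have h4 : |∫ t, g t ∂m| ≤ M := by
    simpa using norm_integral_le_of_norm_le_const (μ := m) (f := g) (.of_forall hM)
  have h5 : (∫ t, u t ∂m) * ((∫ t, v t ∂m) - ∫ t, g t ∂m) ≤ B * ε := by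
    refine (le_abs_self _).trans ?_
    rw [abs_mul]
    exact mul_le_mul h3 h1 (abs_nonneg _) hB0
  have h6 : ((∫ t, u t ∂m) - ∫ t, w t ∂m) * ∫ t, g t ∂m ≤ ε := by
    refine (le_abs_self _).trans ?_
    rw [abs_mul]
    refine (mul_le_mul h2 h4 (abs_nonneg _) (by positivity)).trans_eq ?_
    rw [div_mul_cancel₀ _ hM0.ne']
  linarith

end Average

/-! ### Norms in terms of densities -/

section Norm

variable {G : Type*} [MeasurableSpace G] {m : Measure G}
  {X : Type*} [NormedAddCommGroup X] [NormedSpace ℂ X]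
  {ν : VectorMeasure G X} {D : (X →L[ℂ] ℂ) →L[ℂ] Lp ℂ 1 m}

/-- A norming functional from Hahn–Banach turns the norm into an integral against one density, where
only `|ψ| ≤ |φ|` matters. -/
lemma norm_simpleIntegral_le
    (hD : ∀ x' A, MeasurableSet A → ∫ t in A, D x' t ∂m = x' (ν A)) {φ ψ : SimpleFunc G ℂ}
    (hψ : ∀ t, ‖ψ t‖ ≤ ‖φ t‖) {C : ℝ}
    (hC : ∀ y' : X →L[ℂ] ℂ, ‖y'‖ ≤ 1 → ∫ t, ‖φ t‖ * ‖D y' t‖ ∂m ≤ C) :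
    ‖simpleIntegral ν ψ‖ ≤ C := by
  obtain ⟨y', hy', hy⟩ := exists_dual_vector'' ℂ (simpleIntegral ν ψ)
  obtain ⟨K, hK⟩ := φ.exists_forall_norm_le
  have hint := L1.integrable_coeFn (D y')
  calc ‖simpleIntegral ν ψ‖ = ‖y' (simpleIntegral ν ψ)‖ := by rw [hy]; simp
    _ = ‖∫ t, ψ t * D y' t ∂m‖ := by rw [apply_simpleIntegral hint (hD y')]
    _ ≤ ∫ t, ‖φ t‖ * ‖D y' t‖ ∂m := by
      refine norm_integral_le_of_norm_le
        (hint.norm.bdd_mul (c := K) φ.aestronglyMeasurable.norm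
          (.of_forall fun t => by simpa using hK t)) (.of_forall fun t => ?_)
      rw [norm_mul]
      exact mul_le_mul_of_nonneg_right (hψ t) (norm_nonneg _)
    _ ≤ C := hC y' hy'

lemma lintegral_absScalarMeasure
    (hD : ∀ x' A, MeasurableSet A → ∫ t in A, D x' t ∂m = x' (ν A)) (x' : X →L[ℂ] ℂ)
    {f : G → ℂ} (hf : Measurable f) :
    ∫⁻ t, ‖f t‖ₑ ∂absScalarMeasure ν x' = ∫⁻ t, ‖f t‖ₑ * ‖D x' t‖ₑ ∂m := by
  rw [absScalarMeasure_eq_withDensity (L1.integrable_coeFn (D x')) (hD x'),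
    lintegral_withDensity_eq_lintegral_mul _ (Lp.stronglyMeasurable (D x')).measurable.enorm
      hf.enorm]
  simp [mul_comm]

lemma l1Norm_one : l1Norm ν (fun _ => 1) = totalSemivariation ν := by
  simp [l1Norm, totalSemivariation, semivariation]

lemma totalSemivariation_lt_top
    (hD : ∀ x' A, MeasurableSet A → ∫ t in A, D x' t ∂m = x' (ν A)) :
    totalSemivariation ν < ∞ := by
  rw [← l1Norm_one]
  refine lt_of_le_of_lt (iSup₂_le fun x' hx' => ?_) (ENNReal.ofReal_lt_top (r := ‖D‖))
  rw [lintegral_absScalarMeasure hD x' measurable_const]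
  simp only [enorm_one, one_mul]
  rw [← ofReal_integral_norm_eq_lintegral_enorm (L1.integrable_coeFn (D x')),
    ← L1.norm_eq_integral_norm]
  exact ENNReal.ofReal_le_ofReal (D.unit_le_opNorm x' hx')

end Norm

/-! ### The embedding of `L¹(ν)` into `L¹(m)` -/

section Invariance

variable {G : Type*} [Group G] [TopologicalSpace G] [IsTopologicalGroup G]
  [MeasurableSpace G] [BorelSpace G] {m : Measure G}
  {X : Type*} [NormedAddCommGroup X] [NormedSpace ℂ X]
  {ν : VectorMeasure G X} {D : (X →L[ℂ] ℂ) →L[ℂ] Lp ℂ 1 m}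

/-- Norm integral invariance bounds the translates of `φ` against every density. -/
lemma IsNormIntegralTranslationInvariant.integral_translate_le
    (hinv : IsNormIntegralTranslationInvariant ν)
    (hD : ∀ x' A, MeasurableSet A → ∫ t in A, D x' t ∂m = x' (ν A)) (φ : SimpleFunc G ℂ) {C : ℝ}
    (hC : ∀ y' : X →L[ℂ] ℂ, ‖y'‖ ≤ 1 → ∫ t, ‖φ t‖ * ‖D y' t‖ ∂m ≤ C)
    {x' : X →L[ℂ] ℂ} (hx' : ‖x'‖ ≤ 1) (s : G) :
    ∫ t, ‖φ (s * t)‖ * ‖D x' t‖ ∂m ≤ C := by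
  have hfm := (Lp.stronglyMeasurable (D x')).measurable
  set f : G → ℂ := ⇑(D x')
  have hfi : Integrable f m := L1.integrable_coeFn (D x')
  -- The conjugate phase of `f`, equal to `0` where `f` vanishes because `0⁻¹ = 0`. Simple functions
  -- bounded by `1` approximate it.
  let sgn : G → ℂ := fun t => (‖f t‖ : ℂ)⁻¹ * starRingEnd ℂ (f t)
  have hsgn : StronglyMeasurable sgn := by
    refine Measurable.stronglyMeasurable ?_
    fun_prop
  have hsgn1 (t : G) : ‖sgn t‖ ≤ 1 := by
    simp only [sgn, norm_mul, norm_inv, Complex.norm_real, norm_norm, RCLike.norm_conj]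
    exact inv_mul_le_one
  have hsgnf (t : G) : sgn t * f t = ‖f t‖ := by
    simp only [sgn]
    rw [mul_assoc, mul_comm (starRingEnd ℂ _), Complex.mul_conj, Complex.normSq_eq_norm_sq]
    by_cases h : f t = 0
    · simp [h]
    · have : (‖f t‖ : ℂ) ≠ 0 := by simpa using h
      push_cast
      field_simp
  let σ : ℕ → SimpleFunc G ℂ := hsgn.approxBounded 1
  have hσ1 (k : ℕ) (t : G) : ‖σ k t‖ ≤ 1 := hsgn.norm_approxBounded_le zero_le_one k t
  have hσ (t : G) : Tendsto (fun k => σ k t) atTop (𝓝 (sgn t)) :=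
    hsgn.tendsto_approxBounded_of_norm_le (hsgn1 t)
  obtain ⟨K, hK⟩ := φ.exists_forall_norm_le
  -- Pre-translating `σ k` by `s⁻¹` makes `ψ k (s * t) = |φ (s * t)| σ k t`: after translation the
  -- phase matches `f`, while `|ψ k| ≤ |φ|` still holds.
  let ψ : ℕ → SimpleFunc G ℂ := fun k => (φ.map fun z => (‖z‖ : ℂ)) *
    (σ k).comp (fun t => s⁻¹ * t) (measurable_const_mul s⁻¹)
  have hle (k : ℕ) : ‖∫ t, (‖φ (s * t)‖ : ℂ) * σ k t * f t ∂m‖ ≤ C := by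
    have hψ : ‖simpleIntegral ν (ψ k)‖ ≤ C := by
      refine norm_simpleIntegral_le hD (fun t => ?_) hC
      simp only [ψ, SimpleFunc.coe_mul, Pi.mul_apply, SimpleFunc.coe_map, SimpleFunc.coe_comp,
        Function.comp_apply, norm_mul, Complex.norm_real, norm_norm]
      exact mul_le_of_le_one_right (norm_nonneg _) (hσ1 k _)
    rw [← hinv s⁻¹ (ψ k)] at hψ
    refine le_trans ?_ hψ
    refine le_trans (le_of_eq ?_) (x'.le_of_opNorm_le hx' _ |>.trans_eq (one_mul _))
    rw [apply_simpleIntegral hfi (hD x')]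
    simp [ψ, Homeomorph.mulLeft_symm]
  have hlim : Tendsto (fun k => ∫ t, (‖φ (s * t)‖ : ℂ) * σ k t * f t ∂m) atTop
      (𝓝 (∫ t, (‖φ (s * t)‖ : ℂ) * sgn t * f t ∂m)) := by
    refine tendsto_integral_of_dominated_convergence (fun t => K * ‖f t‖) (fun k => ?_)
      (hfi.norm.const_mul K) (fun k => .of_forall fun t => ?_) (.of_forall fun t => ?_)
    · have := (φ.measurable.comp (measurable_const_mul s))
      have h2 := (σ k).measurable
      refine Measurable.aestronglyMeasurable ?_
      exact ((Complex.measurable_ofReal.comp this.norm).mul h2).mul hfm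
    · simp only [norm_mul, Complex.norm_real, norm_norm]
      refine mul_le_mul_of_nonneg_right ?_ (norm_nonneg _)
      exact (mul_le_of_le_one_right (norm_nonneg _) (hσ1 k _)).trans (hK _)
    · exact ((hσ t).const_mul _).mul_const _
  have heq : ∫ t, (‖φ (s * t)‖ : ℂ) * sgn t * f t ∂m
      = ((∫ t, ‖φ (s * t)‖ * ‖f t‖ ∂m : ℝ) : ℂ) := by
    rw [← integral_complex_ofReal]
    congr 1 with t
    rw [mul_assoc, hsgnf, Complex.ofReal_mul]
  have := le_of_tendsto hlim.norm (.of_forall hle)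
  rw [heq, Complex.norm_real] at this
  exact (le_abs_self _).trans this

variable [CompactSpace G] [m.IsHaarMeasure] [IsProbabilityMeasure m]

lemma IsNormIntegralTranslationInvariant.totalSemivariation_mul_lintegral_simpleFunc_le
    (hinv : IsNormIntegralTranslationInvariant ν)
    (hD : ∀ x' A, MeasurableSet A → ∫ t in A, D x' t ∂m = x' (ν A)) (φ : SimpleFunc G ℂ) :
    totalSemivariation ν * ∫⁻ t, ‖φ t‖ₑ ∂m ≤ l1Norm ν φ := by
  by_cases htop : l1Norm ν φ = ∞
  · simp [htop]
  obtain ⟨K, hK⟩ := φ.exists_forall_norm_le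
  have hφi : Integrable φ m := .of_bound φ.aestronglyMeasurable K (.of_forall hK)
  have hC (y' : X →L[ℂ] ℂ) (hy' : ‖y'‖ ≤ 1) :
      ∫ t, ‖φ t‖ * ‖D y' t‖ ∂m ≤ (l1Norm ν φ).toReal := by
    have h1 : ∫⁻ t, ‖φ t‖ₑ * ‖D y' t‖ₑ ∂m ≤ l1Norm ν φ := by
      rw [← lintegral_absScalarMeasure hD y' φ.measurable]
      exact le_iSup₂ (f := fun (x' : X →L[ℂ] ℂ) (_ : ‖x'‖ ≤ 1) =>
        ∫⁻ t, ‖φ t‖ₑ ∂(absScalarMeasure ν x')) y' hy'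
    have h2 : Integrable (fun t => φ t * D y' t) m :=
      (L1.integrable_coeFn (D y')).bdd_mul φ.aestronglyMeasurable (.of_forall hK)
    rw [← ENNReal.ofReal_le_iff_le_toReal htop]
    refine le_trans (le_of_eq ?_) h1
    simp_rw [← enorm_mul, ← norm_mul]
    exact ofReal_integral_norm_eq_lintegral_enorm h2
  rw [totalSemivariation, semivariation, ENNReal.iSup_mul]
  refine iSup_le fun x' => ?_
  rw [ENNReal.iSup_mul]
  refine iSup_le fun hx' => ?_
  have hfi := L1.integrable_coeFn (D x')
  have hfirst : absScalarMeasure ν x' Set.univ = ENNReal.ofReal (∫ t, ‖D x' t‖ ∂m) := by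
    rw [absScalarMeasure_eq_withDensity hfi (hD x'), withDensity_apply _ MeasurableSet.univ,
      setLIntegral_univ, ofReal_integral_norm_eq_lintegral_enorm hfi]
  rw [hfirst, ← ofReal_integral_norm_eq_lintegral_enorm hφi,
    ← ENNReal.ofReal_mul (by positivity), ENNReal.ofReal_le_iff_le_toReal htop, mul_comm]
  exact integral_mul_integral_le_of_forall hφi.norm (fun t => by simpa using hK t) hfi.norm
    fun s => hinv.integral_translate_le hD φ hC hx' s

/-- `‖ν‖ ∫ |f| dm ≤ ‖f‖_ν`: the space `L¹(ν)` embeds in `L¹(m)`. -/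
theorem IsNormIntegralTranslationInvariant.totalSemivariation_mul_lintegral_le
    (hinv : IsNormIntegralTranslationInvariant ν)
    (hD : ∀ x' A, MeasurableSet A → ∫ t in A, D x' t ∂m = x' (ν A)) (f : G → ℂ) :
    totalSemivariation ν * ∫⁻ t, ‖f t‖ₑ ∂m ≤ l1Norm ν f := by
  rw [lintegral_eq_nnreal, ENNReal.mul_iSup]
  refine iSup_le fun φ => ?_
  rw [ENNReal.mul_iSup]
  refine iSup_le fun hφ => ?_
  -- The lower integral of `|f|` is a supremum over simple functions below `|f|`, and `‖·‖_ν` is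
  -- monotone in the modulus.
  let ψ : SimpleFunc G ℂ := φ.map fun r : NNReal => ((r : ℝ) : ℂ)
  have hψ (t : G) : ‖ψ t‖ₑ = φ t := by
    simp [ψ, ← ofReal_norm]
  calc totalSemivariation ν * (φ.map ((↑) : NNReal → ℝ≥0∞)).lintegral m
      = totalSemivariation ν * ∫⁻ t, ‖ψ t‖ₑ ∂m := by
        simp_rw [hψ]
        rw [← SimpleFunc.lintegral_eq_lintegral]
        rfl
    _ ≤ l1Norm ν ψ := hinv.totalSemivariation_mul_lintegral_simpleFunc_le hD ψ
    _ ≤ l1Norm ν f := by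
        refine iSup₂_mono fun x' _ => lintegral_mono fun t => ?_
        rw [hψ]
        exact hφ t

end Invariance

/-! ### Transfer of absolute continuity -/

section AbsCont

variable {G : Type*} [MeasurableSpace G] {m : Measure G} {X : Type*} [NormedAddCommGroup X]
  {ν : VectorMeasure G X}

lemma AbsCont.isNull {μ : Measure G} (h : AbsCont ν μ) {A : Set G} (h0 : μ A = 0) :
    IsNull ν A := fun _ hB hBA => h.apply_eq_zero hB (measure_mono_null hBA h0)

/-- The integral of `dm/dμ` over `A` is uniformly small when `μ A` is, which gives the `ε`–`δ` form.
-/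
lemma AbsCont.mono_ac {μ : Measure G} [IsFiniteMeasure m] [SigmaFinite μ] (h : AbsCont ν m)
    (hm : m ≪ μ) : AbsCont ν μ := by
  intro ε hε
  obtain ⟨δ, hδ, H⟩ := h ε hε
  have hfin : ∫⁻ t, m.rnDeriv μ t ∂μ ≠ ∞ := (Measure.lintegral_rnDeriv_lt_top m μ).ne
  obtain ⟨η, hη, H'⟩ := exists_pos_setLIntegral_lt_of_measure_lt hfin
    (ENNReal.ofReal_pos.2 hδ).ne'
  -- The threshold `η` may be infinite, while `AbsCont` asks for a real `δ`.
  have hη' : min η 1 ≠ ∞ := (min_le_right _ _).trans_lt ENNReal.one_lt_top |>.ne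
  refine ⟨(min η 1).toReal, ENNReal.toReal_pos (by positivity) hη', fun A hA hμ => H A hA ?_⟩
  rw [ENNReal.ofReal_toReal hη'] at hμ
  rw [← Measure.setLIntegral_rnDeriv hm]
  exact H' A (hμ.trans_le (min_le_left _ _))

end AbsCont

/-! ### Null sets, constants and positivity of the semivariation -/

section Control

variable {G : Type*} [MeasurableSpace G] {X : Type*} [NormedAddCommGroup X] [NormedSpace ℂ X]
  {ν : VectorMeasure G X}

lemma totalSemivariation_ne_zero (hν : ν ≠ 0) : totalSemivariation ν ≠ 0 := by
  obtain ⟨A, hA⟩ : ∃ A, ν A ≠ 0 := by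
    by_contra! h
    exact hν (VectorMeasure.ext fun A _ => h A)
  obtain ⟨x', hx', hx⟩ := exists_dual_vector'' ℂ (ν A)
  have h1 : absScalarMeasure ν x' Set.univ ≤ totalSemivariation ν :=
    le_iSup₂ (f := fun (x' : X →L[ℂ] ℂ) (_ : ‖x'‖ ≤ 1) => absScalarMeasure ν x' Set.univ) x' hx'
  have h2 : ‖x' (ν A)‖ₑ ≤ absScalarMeasure ν x' Set.univ :=
    ((scalarMeasure ν x').enorm_measure_le_variation A).trans (measure_mono (Set.subset_univ A))
  intro h0
  rw [h0] at h1
  have h3 : ‖x' (ν A)‖ₑ = 0 := le_antisymm (h2.trans h1) zero_le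
  rw [enorm_eq_zero, hx] at h3
  exact hA (norm_eq_zero.1 (by simpa using h3))

lemma IsNull.absScalarMeasure_eq_zero {A : Set G} (hA : MeasurableSet A) (h : IsNull ν A)
    (x' : X →L[ℂ] ℂ) : absScalarMeasure ν x' A = 0 := by
  rw [absScalarMeasure, VectorMeasure.variation_apply_eq_zero hA]
  intro B hBA hB
  change x' (ν B) = 0
  rw [h B hB hBA, map_zero]

lemma IsNull.l1Norm_indicator_eq_zero {A : Set G} (hA : MeasurableSet A) (h : IsNull ν A) :
    l1Norm ν (A.indicator fun _ => 1) = 0 := by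
  simp only [l1Norm, ENNReal.iSup_eq_zero]
  intro x' _
  simp_rw [enorm_indicator_eq_indicator_enorm]
  rw [lintegral_indicator hA]
  simp [h.absScalarMeasure_eq_zero hA x']

lemma l1Norm_const (c : ℂ) : l1Norm ν (fun _ => c) = ‖c‖ₑ * totalSemivariation ν := by
  simp [l1Norm, totalSemivariation, semivariation, ENNReal.mul_iSup]

lemma memL1_const (h : totalSemivariation ν < ∞) (c : ℂ) : MemL1 ν fun _ => c := by
  refine ⟨⟨measurable_const, by rw [l1Norm_const]; finiteness⟩,
    fun ε hε => ⟨SimpleFunc.const G c, ?_⟩⟩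
  simpa [l1Norm] using hε

end Control

/-! ### Control measures and the density of Haar measure -/

section Rybakov

variable {G : Type*} [Group G] [TopologicalSpace G] [IsTopologicalGroup G] [CompactSpace G]
  [MeasurableSpace G] [BorelSpace G] {m : Measure G} [m.IsHaarMeasure] [IsProbabilityMeasure m]
  {X : Type*} [NormedAddCommGroup X] [NormedSpace ℂ X]
  {ν : VectorMeasure G X} {D : (X →L[ℂ] ℂ) →L[ℂ] Lp ℂ 1 m}

lemma IsNormIntegralTranslationInvariant.measure_eq_zero_of_isNull
    (hinv : IsNormIntegralTranslationInvariant ν) (hν : ν ≠ 0)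
    (hD : ∀ x' A, MeasurableSet A → ∫ t in A, D x' t ∂m = x' (ν A)) {A : Set G}
    (hA : MeasurableSet A) (h : IsNull ν A) : m A = 0 := by
  have := hinv.totalSemivariation_mul_lintegral_le hD (A.indicator fun _ => 1)
  rw [h.l1Norm_indicator_eq_zero hA] at this
  simp_rw [enorm_indicator_eq_indicator_enorm] at this
  rw [lintegral_indicator hA] at this
  simpa [totalSemivariation_ne_zero hν] using this

/-- Rybakov's theorem for norm integral translation invariant vector measures. -/
lemma IsNormIntegralTranslationInvariant.exists_isRybakovControl
    (hinv : IsNormIntegralTranslationInvariant ν) (hν : ν ≠ 0) (hac : AbsCont ν m)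
    (hD : ∀ x' A, MeasurableSet A → ∫ t in A, D x' t ∂m = x' (ν A)) :
    ∃ μ, IsRybakovControl ν μ := by
  obtain ⟨x', hx'⟩ := exists_forall_ae_eq_zero_imp D
  have hi := L1.integrable_coeFn (D x')
  have hmeas := (Lp.stronglyMeasurable (D x')).measurable
  have hA : MeasurableSet {t | D x' t = 0} := hmeas (measurableSet_singleton 0)
  -- Every density vanishes almost everywhere on the zero set of the maximal one, and the dual
  -- separates points.
  have hnull : IsNull ν {t | D x' t = 0} := by
    intro B hB hBA
    refine SeparatingDual.eq_zero_of_forall_dual_eq_zero (R := ℂ) fun y' => ?_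
    rw [← hD y' B hB]
    refine setIntegral_eq_zero_of_ae_eq_zero ?_
    filter_upwards [hx' y'] with t ht htB
    exact ht (hBA htB)
  have h0 := hinv.measure_eq_zero_of_isNull hν hD hA hnull
  have heq := absScalarMeasure_eq_withDensity hi (hD x')
  have hfin : IsFiniteMeasure (absScalarMeasure ν x') := by
    rw [heq]
    exact isFiniteMeasure_withDensity hi.2.ne
  have hmac : m ≪ absScalarMeasure ν x' := by
    rw [heq]
    refine withDensity_absolutelyContinuous' hmeas.enorm.aemeasurable ?_
    filter_upwards [measure_eq_zero_iff_ae_notMem.1 h0] with t ht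
    simpa using ht
  exact ⟨_, hfin, hac.mono_ac hmac, x', rfl⟩

/-- Haar measure has a positive density of norm `‖ν‖⁻¹` in the Köthe dual, with respect to any
Rybakov control measure. -/
lemma IsNormIntegralTranslationInvariant.exists_density_of_isRybakovControl
    (hinv : IsNormIntegralTranslationInvariant ν) (hν : ν ≠ 0)
    (hD : ∀ x' A, MeasurableSet A → ∫ t in A, D x' t ∂m = x' (ν A)) {μ : Measure G}
    (hμ : IsRybakovControl ν μ) :
    ∃ h : G → ℝ, (∀ t, 0 < h t) ∧ MemKotheDual ν μ (fun t => (h t : ℂ)) ∧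
      kotheDualNorm ν μ (fun t => (h t : ℂ)) = (totalSemivariation ν)⁻¹ ∧
      ∀ A : Set G, MeasurableSet A → m A = ∫⁻ t in A, ENNReal.ofReal (h t) ∂μ := by
  obtain ⟨-, hνμ, x', rfl⟩ := hμ
  have hi := L1.integrable_coeFn (D x')
  have hmeas := (Lp.stronglyMeasurable (D x')).measurable
  have heq := absScalarMeasure_eq_withDensity hi (hD x')
  have hA : MeasurableSet {t | D x' t = 0} := hmeas (measurableSet_singleton 0)
  have hA0 : absScalarMeasure ν x' {t | D x' t = 0} = 0 := by
    rw [heq, withDensity_apply _ hA]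
    refine setLIntegral_eq_zero hA fun t ht => ?_
    simpa using ht
  have h0 := hinv.measure_eq_zero_of_isNull hν hD hA (hνμ.isNull hA0)
  -- The value `1` on the `m`-null zero set only keeps `h` positive everywhere.
  let h : G → ℝ := fun t => if D x' t = 0 then 1 else ‖D x' t‖⁻¹
  have hpos (t : G) : 0 < h t := by
    simp only [h]
    split_ifs with ht
    · exact one_pos
    · positivity
  have hhm : Measurable h := Measurable.ite hA measurable_const hmeas.norm.inv
  have hdens : m = (absScalarMeasure ν x').withDensity fun t => ENNReal.ofReal (h t) := by
    rw [heq, ← withDensity_mul _ hmeas.enorm hhm.ennreal_ofReal]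
    conv_lhs => rw [← withDensity_one (μ := m)]
    refine withDensity_congr_ae ?_
    filter_upwards [measure_eq_zero_iff_ae_notMem.1 h0] with t ht
    have ht' : D x' t ≠ 0 := ht
    rw [Pi.mul_apply, Pi.one_apply, ← ofReal_norm, ← ENNReal.ofReal_mul (norm_nonneg _)]
    simp only [h, if_neg ht']
    rw [mul_inv_cancel₀ (norm_ne_zero_iff.2 ht'), ENNReal.ofReal_one]
  have hlint {f : G → ℂ} (hf : Measurable f) :
      ∫⁻ t, ‖f t * h t‖ₑ ∂absScalarMeasure ν x' = ∫⁻ t, ‖f t‖ₑ ∂m := by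
    conv_rhs => rw [hdens, lintegral_withDensity_eq_lintegral_mul _ hhm.ennreal_ofReal hf.enorm]
    refine lintegral_congr fun t => ?_
    rw [Pi.mul_apply, enorm_mul, mul_comm, ← ofReal_norm (h t : ℂ), Complex.norm_real,
      Real.norm_of_nonneg (hpos t).le]
  have hs0 := totalSemivariation_ne_zero hν
  have hst := totalSemivariation_lt_top hD
  have hle (f : G → ℂ) : ∫⁻ t, ‖f t‖ₑ ∂m ≤ (totalSemivariation ν)⁻¹ * l1Norm ν f := by
    rw [mul_comm, ← div_eq_mul_inv, ENNReal.le_div_iff_mul_le (.inl hs0) (.inl hst.ne), mul_comm]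
    exact hinv.totalSemivariation_mul_lintegral_le hD f
  have hhc : Measurable fun t => (h t : ℂ) := Complex.measurable_ofReal.comp hhm
  refine ⟨h, hpos, ⟨hhc, fun f hf => ?_⟩, le_antisymm ?_ ?_, fun A hA => ?_⟩
  · refine ⟨(hf.1.1.mul hhc).aestronglyMeasurable, ?_⟩
    rw [hasFiniteIntegral_iff_enorm, hlint hf.1.1]
    exact (hle f).trans_lt (ENNReal.mul_lt_top (ENNReal.inv_lt_top.2 hs0.bot_lt) hf.1.2)
  · refine iSup_le fun f => iSup₂_le fun hf hf1 => ?_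
    rw [hlint hf.1.1]
    exact (hle f).trans (mul_le_of_le_one_right zero_le hf1)
  · let c : ℂ := ((totalSemivariation ν)⁻¹.toReal : ℂ)
    have hc : ‖c‖ₑ = (totalSemivariation ν)⁻¹ := by
      rw [← ofReal_norm, Complex.norm_real, Real.norm_of_nonneg ENNReal.toReal_nonneg,
        ENNReal.ofReal_toReal (ENNReal.inv_ne_top.2 hs0)]
    have hc1 : l1Norm ν (fun _ => c) ≤ 1 := by
      rw [l1Norm_const, hc, ENNReal.inv_mul_cancel hs0 hst.ne]
    refine le_trans (le_of_eq ?_) (le_iSup_of_le (fun _ => c)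
      (le_iSup₂_of_le (memL1_const hst c) hc1 le_rfl))
    rw [hlint measurable_const]
    simp [hc]
  · conv_lhs => rw [hdens]
    rw [withDensity_apply _ hA]

end Rybakov

end VecMeas

theorem theorem4p1
    {G : Type*} [Group G] [TopologicalSpace G] [IsTopologicalGroup G] [CompactSpace G] [T2Space G]
    [MeasurableSpace G] [BorelSpace G]
    (m : Measure G) [m.IsHaarMeasure] [m.Regular] [IsProbabilityMeasure m]
    {X : Type*} [NormedAddCommGroup X] [NormedSpace ℂ X] [CompleteSpace X]
    (ν : VectorMeasure G X) (hν : ν ≠ 0)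
    (hac : VecMeas.AbsCont ν m)
    (hinv : VecMeas.IsNormIntegralTranslationInvariant ν) :
    (∃ μ : Measure G, VecMeas.IsRybakovControl ν μ) ∧
    (∀ μ : Measure G, VecMeas.IsRybakovControl ν μ →
      ∃ h : G → ℝ, (∀ t, 0 < h t) ∧
        VecMeas.MemKotheDual ν μ (fun t => (h t : ℂ)) ∧
        VecMeas.kotheDualNorm ν μ (fun t => (h t : ℂ)) = (VecMeas.totalSemivariation ν)⁻¹ ∧
        ∀ A : Set G, MeasurableSet A → m A = ∫⁻ t in A, ENNReal.ofReal (h t) ∂μ) ∧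
    (∀ A : Set G, MeasurableSet A → (VecMeas.IsNull ν A ↔ m A = 0)) := by
  obtain ⟨D, hD⟩ := hac.exists_density
  exact ⟨hinv.exists_isRybakovControl hν hac hD,
    fun μ hμ => hinv.exists_density_of_isRybakovControl hν hD hμ,
    fun A hA => ⟨hinv.measure_eq_zero_of_isNull hν hD hA, hac.isNull⟩⟩
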